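/- Conventions. In a topological space, the Borel sets of additive class $0$ are the open sets; for an ordinal $0<\alpha<\omega_1$, a set is of additive class $\alpha$ if it is a countable union of sets each of which is of multiplicative class $\beta$ for some $\beta<\alpha$, where a set is of multiplicative class $\beta$ if its complement is of additive class $\beta$ (so additive class $1$ means $F_\sigma$). A function is of Borel class $\alpha$ if the preimage of every open set is of additive class $\alpha$. A family of subsets of a topological space is discrete if every point of the space has a neighbourhood that meets at most one member of the family, and $\sigma$-discrete if it is a countable union of discrete families. Let $Y$ and $(Z,d)$ be metric spaces and $1\le\alpha<\omega_1$. A family $\mathscr F\subseteq Z^Y$ of functions is called equi-$\alpha$-GLP if for every $\varepsilon>0$ there is a $\sigma$-discrete family $\mathcal A_\varepsilon$ of subsets of $Y$ of additive class $\alpha$ such that $Y=\bigcup\mathcal A_\varepsilon$ and $\operatorname{diam} g(A)\le\varepsilon$ for all $A\in\mathcal A_\varepsilon$ and all $g\in\mathscr F$. Theorem. Let $X$, $Y$ and $(Z,d)$ be metric spaces, let $1\le\alpha<\omega_1$, and let $f\colon X\times Y\to Z$ be a function such that 1. the family $\{f^x: x\in X\}$ of $x$-sections $f^x\colon Y\to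 Z$, $f^x(y)=f(x,y)$, is equi-$\alpha$-GLP; and 2. for every $y\in Y$ the $y$-section $f_y\colon X\to Z$, $f_y(x)=f(x,y)$, is of Borel class $\alpha$. Then $f$ is of Borel class $\alpha$ on $X\times Y$ (with the product topology). -/

import Mathlib

open Set Topology
open scoped Ordinal

/-- Borel sets of additive class `α` in a topological space. Class `0` consists of the open sets.
For `α > 0`, a set is of additive class `α` if it is a countable union of sets, each of which is
of multiplicative class `β` for some `β < α` (that is, its complement is of additive class `β`).
So additive class `1` is the class of `F_σ` sets. -/
inductive IsBorelAdditive {X : Type*} [TopologicalSpace X] : Ordinal.{0} → Set X → Prop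
  | of_isOpen {U : Set X} (hU : IsOpen U) : IsBorelAdditive 0 U
  | iUnion {α : Ordinal.{0}} (hα : 0 < α) (A : ℕ → Set X) (β : ℕ → Ordinal.{0})
      (hβ : ∀ n, β n < α) (hA : ∀ n, IsBorelAdditive (β n) (A n)ᶜ) :
      IsBorelAdditive α (⋃ n, A n)

/-- A function is of Borel class `α` if preimages of open sets are of additive class `α`. -/
def IsBorelClass {X Y : Type*} [TopologicalSpace X] [TopologicalSpace Y]
    (α : Ordinal.{0}) (f : X → Y) : Prop :=
  ∀ V : Set Y, IsOpen V → IsBorelAdditive α (f ⁻¹' V)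

/-- A family of sets is discrete if every point has a neighbourhood meeting at most one of its
members. -/
def IsDiscreteFamily {X : Type*} [TopologicalSpace X] (𝒜 : Set (Set X)) : Prop :=
  ∀ x : X, ∃ U ∈ 𝓝 x, {A ∈ 𝒜 | (U ∩ A).Nonempty}.Subsingleton

/-- A family of sets is `σ`-discrete if it is a countable union of discrete families. -/
def IsSigmaDiscreteFamily {X : Type*} [TopologicalSpace X] (𝒜 : Set (Set X)) : Prop :=
  ∃ 𝒟 : ℕ → Set (Set X), (∀ n, IsDiscreteFamily (𝒟 n)) ∧ 𝒜 = ⋃ n, 𝒟 n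

/-- A family `ℱ` of functions is equi-`α`-GLP if for every `ε > 0` there is a `σ`-discrete cover
of the domain by sets of additive class `α` on each of which every `f ∈ ℱ` has image of
diameter at most `ε` (the diameter is taken in `[0, ∞]`). -/
def IsEquiGLP {X Y : Type*} [TopologicalSpace X] [MetricSpace Y]
    (α : Ordinal.{0}) (ℱ : Set (X → Y)) : Prop :=
  ∀ ε : ℝ, 0 < ε → ∃ 𝒜 : Set (Set X), IsSigmaDiscreteFamily 𝒜 ∧
    (∀ A ∈ 𝒜, IsBorelAdditive α A) ∧ ⋃₀ 𝒜 = univ ∧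
    ∀ A ∈ 𝒜, ∀ f ∈ ℱ, Metric.ediam (f '' A) ≤ ENNReal.ofReal ε

/-! Take covers `𝒜 n` of `Y` on whose members every `x`-section oscillates by at most `ε n → 0`. On
`A ∈ 𝒜 n`, `f (x, y)` is within `ε n` of `f (x, y')` for any fixed `y' ∈ A`, so `f ⁻¹' V` is a union
of rectangles `T n A ×ˢ A`, where `T n A` is the preimage under one `y`-section of an open set
slightly smaller than `V`. Each rectangle has class `α`.

The union over `A` may be uncountable, but it is `σ`-discrete. Montgomery's lemma, proved by
induction on the class, handles sets inside disjoint open sets; discrete families reduce to it by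
splitting each member into countably many uniformly separated pieces. -/

theorem IsBorelAdditive.exists_iUnion {X : Type*} [TopologicalSpace X] {α : Ordinal.{0}}
    {s : Set X} (hs : IsBorelAdditive α s) (hα : 0 < α) :
    ∃ (A : ℕ → Set X) (β : ℕ → Ordinal.{0}), (∀ n, β n < α) ∧
      (∀ n, IsBorelAdditive (β n) (A n)ᶜ) ∧ s = ⋃ n, A n := by
  cases hs with
  | of_isOpen hU => exact absurd hα (lt_irrefl _)
  | iUnion _ A β hβ hA => exact ⟨A, β, hβ, hA, rfl⟩

theorem IsBorelAdditive.isOpen {X : Type*} [TopologicalSpace X] {s : Set X}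
    (hs : IsBorelAdditive 0 s) : IsOpen s := by
  generalize h : (0 : Ordinal.{0}) = α at hs
  cases hs with
  | of_isOpen hU => exact hU
  | iUnion hα A β hβ hA => exact absurd h hα.ne

/-- The points of a metric space at distance at least `r` from the complement of `U`. -/
def shrinking {X : Type*} [MetricSpace X] (r : ℝ) (U : Set X) : Set X :=
  (Metric.thickening r Uᶜ)ᶜ

theorem mem_shrinking {X : Type*} [MetricSpace X] {r : ℝ} {U : Set X} {x : X} :
    x ∈ shrinking r U ↔ Metric.ball x r ⊆ U := by
  simp only [shrinking, mem_compl_iff, Metric.mem_thickening_iff, not_exists, not_and, not_lt,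
    subset_def, Metric.mem_ball]
  refine forall_congr' fun y => ?_
  rw [dist_comm x y, ← not_imp_not, not_le, not_not]

theorem isClosed_shrinking {X : Type*} [MetricSpace X] (r : ℝ) (U : Set X) :
    IsClosed (shrinking r U) :=
  Metric.isOpen_thickening.isClosed_compl

theorem shrinking_subset {X : Type*} [MetricSpace X] {r : ℝ} (hr : 0 < r) (U : Set X) :
    shrinking r U ⊆ U :=
  fun _ hx => mem_shrinking.1 hx (Metric.mem_ball_self hr)

theorem iUnion_shrinking {X : Type*} [MetricSpace X] {U : Set X} (hU : IsOpen U) :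
    ⋃ n : ℕ, shrinking (1 / (n + 1 : ℝ)) U = U := by
  refine subset_antisymm (iUnion_subset fun n => shrinking_subset Nat.one_div_pos_of_nat U) ?_
  intro x hx
  obtain ⟨r, hr, hrU⟩ := Metric.isOpen_iff.1 hU x hx
  obtain ⟨n, hn⟩ := exists_nat_one_div_lt hr
  exact mem_iUnion.2 ⟨n, mem_shrinking.2 ((Metric.ball_subset_ball hn.le).trans hrU)⟩

theorem IsOpen.isBorelAdditive {X : Type*} [MetricSpace X] {U : Set X} (hU : IsOpen U)
    (α : Ordinal.{0}) : IsBorelAdditive α U := by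
  rcases eq_or_ne α 0 with rfl | hα
  · exact .of_isOpen hU
  · rw [← iUnion_shrinking hU]
    exact .iUnion (pos_iff_ne_zero.2 hα) _ (fun _ => 0) (fun _ => pos_iff_ne_zero.2 hα)
      fun n => .of_isOpen (isClosed_shrinking _ U).isOpen_compl

theorem IsBorelAdditive.mono {X : Type*} [MetricSpace X] {α β : Ordinal.{0}} {s : Set X}
    (hs : IsBorelAdditive β s) (h : β ≤ α) : IsBorelAdditive α s := by
  cases hs with
  | of_isOpen hU => exact hU.isBorelAdditive α
  | iUnion hβ A γ hγ hA => exact .iUnion (hβ.trans_le h) A γ (fun n => (hγ n).trans_le h) hA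

theorem IsBorelAdditive.countable_iUnion {X ι : Type*} [TopologicalSpace X] [Countable ι]
    [Nonempty ι] {α : Ordinal.{0}} {s : ι → Set X} (hs : ∀ i, IsBorelAdditive α (s i)) :
    IsBorelAdditive α (⋃ i, s i) := by
  rcases eq_or_ne α 0 with rfl | hα
  · exact .of_isOpen (isOpen_iUnion fun i => (hs i).isOpen)
  · have hα := pos_iff_ne_zero.2 hα
    choose A β hβ hA hsA using fun i => (hs i).exists_iUnion hα
    obtain ⟨e, he⟩ := exists_surjective_nat (ι × ℕ)
    have : ⋃ i, s i = ⋃ n, A (e n).1 (e n).2 := by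
      rw [he.iUnion_comp (fun p => A p.1 p.2), iUnion_prod']
      exact iUnion_congr hsA
    rw [this]
    exact .iUnion hα _ (fun n => β (e n).1 (e n).2) (fun n => hβ _ _) fun n => hA _ _

theorem IsBorelAdditive.union {X : Type*} [TopologicalSpace X] {α : Ordinal.{0}} {s t : Set X}
    (hs : IsBorelAdditive α s) (ht : IsBorelAdditive α t) : IsBorelAdditive α (s ∪ t) := by
  rw [union_eq_iUnion]
  exact countable_iUnion (by rintro (_ | _) <;> assumption)

theorem IsBorelAdditive.inter {X : Type*} [MetricSpace X] {α : Ordinal.{0}} {s t : Set X}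
    (hs : IsBorelAdditive α s) (ht : IsBorelAdditive α t) : IsBorelAdditive α (s ∩ t) := by
  rcases eq_or_ne α 0 with rfl | hα
  · exact .of_isOpen (hs.isOpen.inter ht.isOpen)
  · have hα := pos_iff_ne_zero.2 hα
    obtain ⟨A, β, hβ, hA, rfl⟩ := hs.exists_iUnion hα
    obtain ⟨B, γ, hγ, hB, rfl⟩ := ht.exists_iUnion hα
    rw [iUnion_inter]
    refine countable_iUnion fun m => ?_
    rw [inter_iUnion]
    refine .iUnion hα _ (fun n => max (β m) (γ n)) (fun n => max_lt (hβ m) (hγ n)) fun n => ?_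
    rw [compl_inter]
    exact ((hA m).mono (le_max_left _ _)).union ((hB n).mono (le_max_right _ _))

theorem IsBorelAdditive.preimage {X Y : Type*} [TopologicalSpace X] [TopologicalSpace Y]
    {α : Ordinal.{0}} {s : Set Y} (hs : IsBorelAdditive α s) {g : X → Y} (hg : Continuous g) :
    IsBorelAdditive α (g ⁻¹' s) := by
  induction hs with
  | of_isOpen hU => exact .of_isOpen (hU.preimage hg)
  | iUnion hα A β hβ hA ih =>
    rw [preimage_iUnion]
    exact .iUnion hα _ β hβ ih

theorem IsBorelAdditive.prod {X Y : Type*} [MetricSpace X] [MetricSpace Y] {α : Ordinal.{0}}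
    {s : Set X} {t : Set Y} (hs : IsBorelAdditive α s) (ht : IsBorelAdditive α t) :
    IsBorelAdditive α (s ×ˢ t) :=
  (hs.preimage continuous_fst).inter (ht.preimage continuous_snd)

/-! ### Montgomery's lemma -/

/-- Sets of the same countable additive class are countable unions of sets whose multiplicative
classes do not depend on the set. -/
theorem IsBorelAdditive.exists_iUnion_uniform {X ι : Type*} [MetricSpace X] {α : Ordinal.{0}}
    (hα : 0 < α) (hα' : α < ω₁) {s : ι → Set X} (hs : ∀ i, IsBorelAdditive α (s i)) :
    ∃ (γ : ℕ → Ordinal.{0}) (B : ι → ℕ → Set X), (∀ n, γ n < α) ∧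
      (∀ i n, IsBorelAdditive (γ n) (B i n)ᶜ) ∧ ∀ i, s i = ⋃ n, B i n := by
  classical
  choose A β hβ hA hsA using fun i => (hs i).exists_iUnion hα
  have : Countable (Iio α) := by
    rw [← Cardinal.mk_le_aleph0_iff, Cardinal.mk_Iio_ordinal, Cardinal.lift_le_aleph0,
      ← Order.lt_succ_iff, Cardinal.succ_aleph0]
    exact Cardinal.lt_omega_iff_card_lt.1 hα'
  have : Nonempty (Iio α) := ⟨⟨0, hα⟩⟩
  obtain ⟨e, he⟩ := exists_surjective_nat (Iio α × ℕ)
  -- Since `α` is countable, `e` lists every pair (class, index). A piece whose class is not the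
  -- listed one is replaced by `∅`, whose complement is open and so of every class.
  refine ⟨fun n => (e n).1, fun i n => if β i (e n).2 = (e n).1 then A i (e n).2 else ∅,
    fun n => (e n).1.2, fun i n => ?_, fun i => ?_⟩
  · dsimp only
    split_ifs with h
    · exact h ▸ hA _ _
    · rw [compl_empty]
      exact isOpen_univ.isBorelAdditive _
  · rw [hsA]
    refine subset_antisymm (iUnion_subset fun n => ?_) (iUnion_subset fun n => ?_)
    · obtain ⟨m, hm⟩ := he (⟨β i n, hβ i n⟩, n)
      refine subset_iUnion_of_subset m ?_
      simp [hm]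
    · dsimp only
      split_ifs
      · exact subset_iUnion (A i) _
      · exact empty_subset _

theorem closure_iUnion_shrinking_subset {X ι : Type*} [MetricSpace X] {r : ℝ} (hr : 0 < r)
    (U : ι → Set X) : closure (⋃ i, shrinking r (U i)) ⊆ ⋃ i, U i := by
  intro x hx
  obtain ⟨y, hy, hxy⟩ := Metric.mem_closure_iff.1 hx r hr
  obtain ⟨i, hi⟩ := mem_iUnion.1 hy
  exact mem_iUnion.2 ⟨i, mem_shrinking.1 hi hxy⟩

/-- A form of Montgomery's lemma: additive classes are stable under unions of sets that lie in
pairwise disjoint open sets. -/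
theorem IsBorelAdditive.iUnion_of_pairwise_disjoint {X ι : Type*} [MetricSpace X]
    {U : ι → Set X} (hU : ∀ i, IsOpen (U i)) (hd : Pairwise (Function.onFun Disjoint U)) {α : Ordinal.{0}}
    (hα : α < ω₁) {s : ι → Set X} (hs : ∀ i, IsBorelAdditive α (s i)) (hsU : ∀ i, s i ⊆ U i) :
    IsBorelAdditive α (⋃ i, s i) := by
  induction α using WellFoundedLT.induction generalizing s with
  | ind α ih =>
  rcases eq_or_ne α 0 with rfl | h0
  · exact .of_isOpen (isOpen_iUnion fun i => (hs i).isOpen)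
  have h0 := pos_iff_ne_zero.2 h0
  obtain ⟨γ, B, hγ, hB, hsB⟩ := exists_iUnion_uniform h0 hα hs
  have key : ⋃ i, s i =
      ⋃ k : ℕ, ⋃ n, ⋃ i, B i n ∩ shrinking (1 / (k + 1 : ℝ)) (U i) := by
    ext x
    simp only [mem_iUnion, mem_inter_iff]
    constructor
    · rintro ⟨i, hi⟩
      have h1 := hsU i hi
      rw [← iUnion_shrinking (hU i)] at h1
      rw [hsB] at hi
      obtain ⟨k, hk⟩ := mem_iUnion.1 h1
      obtain ⟨n, hn⟩ := mem_iUnion.1 hi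
      exact ⟨k, n, i, hn, hk⟩
    · rintro ⟨k, n, i, hn, -⟩
      exact ⟨i, hsB i ▸ mem_iUnion.2 ⟨n, hn⟩⟩
  rw [key]
  refine countable_iUnion fun k => .iUnion h0 _ γ hγ fun n => ?_
  have hk : (0 : ℝ) < 1 / (k + 1 : ℝ) := Nat.one_div_pos_of_nat
  set C : ι → Set X := fun i => shrinking (1 / (k + 1 : ℝ)) (U i) with hC
  -- A point of the closure lies in some `U i`, and there, by disjointness, only the `i`-th piece
  -- matters. The induction hypothesis for `γ n < α` then applies to the second union.
  have hcompl : (⋃ i, B i n ∩ C i)ᶜ = (closure (⋃ i, C i))ᶜ ∪ ⋃ i, U i ∩ (B i n ∩ C i)ᶜ := by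
    ext x
    simp only [mem_compl_iff, mem_union, mem_iUnion, mem_inter_iff, not_exists]
    constructor
    · intro h
      by_cases hx : x ∈ closure (⋃ i, C i)
      · obtain ⟨i, hi⟩ := mem_iUnion.1 (closure_iUnion_shrinking_subset hk U hx)
        exact .inr ⟨i, hi, h i⟩
      · exact .inl hx
    · rintro (h | ⟨i, hi, h⟩) j hj
      · exact h (subset_closure (mem_iUnion.2 ⟨j, hj.2⟩))
      · have hij : i = j := by
          by_contra hij
          exact disjoint_left.1 (hd hij) hi (shrinking_subset hk _ hj.2)
        exact h (hij ▸ hj)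
  rw [hcompl]
  refine (isClosed_closure.isOpen_compl.isBorelAdditive _).union
    (ih _ (hγ n) ((hγ n).trans hα) (fun i => ?_) fun i => inter_subset_left)
  refine ((hU i).isBorelAdditive _).inter ?_
  rw [compl_inter]
  exact (hB i n).union ((isClosed_shrinking _ _).isOpen_compl.isBorelAdditive _)

/-! ### Unions indexed by discrete families -/

/-- The points of `A` whose ball of radius `2 * r` meets no member of `𝒟` other than `A`. -/
def isolatedPart {Y : Type*} [MetricSpace Y] (𝒟 : Set (Set Y)) (r : ℝ) (A : Set Y) : Set Y :=
  {y ∈ A | ∀ B ∈ 𝒟, (Metric.ball y (2 * r) ∩ B).Nonempty → B = A}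

/-- Points within `r` of a common point are less than `2 * r` apart, hence the factor in
`isolatedPart`. -/
theorem disjoint_thickening_isolatedPart {Y : Type*} [MetricSpace Y] {𝒟 : Set (Set Y)} {r : ℝ}
    {A B : Set Y} (hB : B ∈ 𝒟) (hAB : A ≠ B) :
    Disjoint (Metric.thickening r (isolatedPart 𝒟 r A))
      (Metric.thickening r (isolatedPart 𝒟 r B)) := by
  refine disjoint_left.2 fun y hyA hyB => ?_
  obtain ⟨a, ha, hya⟩ := Metric.mem_thickening_iff.1 hyA
  obtain ⟨b, hb, hyb⟩ := Metric.mem_thickening_iff.1 hyB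
  refine hAB (ha.2 B hB ⟨b, ?_, hb.1⟩).symm
  rw [Metric.mem_ball]
  linarith [dist_triangle_left b a y]

theorem IsDiscreteFamily.exists_mem_isolatedPart {Y : Type*} [MetricSpace Y] {𝒟 : Set (Set Y)}
    (h𝒟 : IsDiscreteFamily 𝒟) {A : Set Y} (hA : A ∈ 𝒟) {y : Y} (hy : y ∈ A) :
    ∃ k : ℕ, y ∈ isolatedPart 𝒟 (1 / (k + 1 : ℝ)) A := by
  obtain ⟨U, hU, hsub⟩ := h𝒟 y
  obtain ⟨r, hr, hrU⟩ := Metric.mem_nhds_iff.1 hU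
  obtain ⟨k, hk⟩ := exists_nat_one_div_lt (half_pos hr)
  refine ⟨k, hy, fun B hB hne => hsub ⟨hB, hne.mono ?_⟩ ⟨hA, y, mem_of_mem_nhds hU, hy⟩⟩
  exact inter_subset_inter_left _ ((Metric.ball_subset_ball (by linarith)).trans hrU)

theorem IsDiscreteFamily.isBorelAdditive_iUnion {X Y : Type*} [MetricSpace X] [MetricSpace Y]
    {α : Ordinal.{0}} (hα : α < ω₁) {𝒟 : Set (Set Y)} (h𝒟 : IsDiscreteFamily 𝒟) {g : X → Y}
    (hg : Continuous g) {s : 𝒟 → Set X} (hs : ∀ A, IsBorelAdditive α (s A))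
    (hsA : ∀ A, s A ⊆ g ⁻¹' A) : IsBorelAdditive α (⋃ A, s A) := by
  let U : ℕ → 𝒟 → Set X := fun k A =>
    g ⁻¹' Metric.thickening (1 / (k + 1 : ℝ)) (isolatedPart 𝒟 (1 / (k + 1 : ℝ)) A)
  have hU : ∀ k A, IsOpen (U k A) := fun k A => Metric.isOpen_thickening.preimage hg
  have key : ⋃ A, s A = ⋃ k, ⋃ A, s A ∩ U k A := by
    refine subset_antisymm (iUnion_subset fun A x hx => ?_)
      (iUnion_subset fun k => iUnion_mono fun A => inter_subset_left)
    obtain ⟨k, hk⟩ := h𝒟.exists_mem_isolatedPart A.2 (hsA A hx)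
    exact mem_iUnion.2 ⟨k, mem_iUnion.2
      ⟨A, hx, Metric.self_subset_thickening Nat.one_div_pos_of_nat _ hk⟩⟩
  rw [key]
  refine .countable_iUnion fun k => .iUnion_of_pairwise_disjoint (hU k) (fun A B hAB => ?_) hα
    (fun A => (hs A).inter ((hU k A).isBorelAdditive α)) fun A => inter_subset_right
  exact (disjoint_thickening_isolatedPart B.2 (Subtype.coe_ne_coe.2 hAB)).preimage g

theorem IsSigmaDiscreteFamily.isBorelAdditive_iUnion {X Y : Type*} [MetricSpace X]
    [MetricSpace Y] {α : Ordinal.{0}} (hα : α < ω₁) {𝒜 : Set (Set Y)}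
    (h𝒜 : IsSigmaDiscreteFamily 𝒜) {g : X → Y} (hg : Continuous g) {s : 𝒜 → Set X}
    (hs : ∀ A, IsBorelAdditive α (s A)) (hsA : ∀ A, s A ⊆ g ⁻¹' A) :
    IsBorelAdditive α (⋃ A, s A) := by
  obtain ⟨𝒟, h𝒟, rfl⟩ := h𝒜
  have key : ⋃ A, s A = ⋃ n, ⋃ A : 𝒟 n, s ⟨A, mem_iUnion.2 ⟨n, A.2⟩⟩ := by
    ext x
    simp only [mem_iUnion]
    constructor
    · rintro ⟨⟨A, hA⟩, hx⟩
      obtain ⟨n, hn⟩ := mem_iUnion.1 hA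
      exact ⟨n, ⟨A, hn⟩, hx⟩
    · rintro ⟨n, A, hx⟩
      exact ⟨_, hx⟩
  rw [key]
  exact .countable_iUnion fun n =>
    (h𝒟 n).isBorelAdditive_iUnion hα hg (fun A => hs _) fun A => hsA _

/-! ### Preimages of open sets as unions of rectangles -/

theorem mainTheorem1 {X Y Z : Type*} [MetricSpace X] [MetricSpace Y] [MetricSpace Z]
    (α : Ordinal.{0}) (hα : 1 ≤ α) (hα' : α < ω₁) (f : X × Y → Z)
    (hX : IsEquiGLP α (range fun (x : X) (y : Y) => f (x, y)))
    (hY : ∀ y : Y, IsBorelClass α fun x : X => f (x, y)) :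
    IsBorelClass α f := by
  intro V hV
  let ε : ℕ → ℝ := fun n => 1 / (n + 1 : ℝ)
  have hε : ∀ n, 0 < ε n := fun n => Nat.one_div_pos_of_nat
  choose 𝒜 hσ hadd hcov hdiam using fun n => hX (ε n) (hε n)
  have hdist : ∀ n, ∀ A ∈ 𝒜 n, ∀ x, ∀ y ∈ A, ∀ y' ∈ A, dist (f (x, y)) (f (x, y')) ≤ ε n := by
    intro n A hA x y hy y' hy'
    rw [← edist_le_ofReal (hε n).le]
    exact (Metric.edist_le_ediam_of_mem (mem_image_of_mem _ hy) (mem_image_of_mem _ hy')).trans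
      (hdiam n A hA _ (mem_range_self x))
  -- Replacing `y` by `y'` moves the value by at most `ε n`. The open radius `2 * ε n` absorbs this
  -- going in; going back the total is below `3 * ε n`, which stays in `V`.
  let W : ℕ → Set Z := fun n => ⋃ z ∈ shrinking (3 * ε n) V, Metric.ball z (2 * ε n)
  have hW : ∀ n, IsOpen (W n) := fun n => isOpen_biUnion fun z _ => Metric.isOpen_ball
  have hsec : ∀ n, ∀ A : 𝒜 n, ∃ T : Set X, IsBorelAdditive α T ∧
      ∀ y ∈ (A : Set Y), ∃ y' ∈ (A : Set Y), T = {x | f (x, y') ∈ W n} := by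
    intro n A
    -- An empty member has no base point; its rectangle is empty anyway.
    rcases (A : Set Y).eq_empty_or_nonempty with h | ⟨y', hy'⟩
    · exact ⟨∅, isOpen_empty.isBorelAdditive α, by simp [h]⟩
    · exact ⟨_, hY y' (W n) (hW n), fun y _ => ⟨y', hy', rfl⟩⟩
  choose T hT hTf using hsec
  have key : f ⁻¹' V = ⋃ n, ⋃ A : 𝒜 n, T n A ×ˢ (A : Set Y) := by
    ext ⟨x, y⟩
    simp only [mem_preimage, mem_iUnion, mem_prod]
    constructor
    · intro hxy
      obtain ⟨r, hr, hrV⟩ := Metric.isOpen_iff.1 hV _ hxy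
      obtain ⟨n, hn⟩ := exists_nat_one_div_lt (show 0 < r / 3 by positivity)
      obtain ⟨A, hA, hyA⟩ := mem_sUnion.1 (hcov n ▸ mem_univ y)
      refine ⟨n, ⟨A, hA⟩, ?_, hyA⟩
      obtain ⟨y', hy', hTy⟩ := hTf n ⟨A, hA⟩ y hyA
      rw [hTy]
      refine mem_iUnion₂.2 ⟨f (x, y), mem_shrinking.2 ?_, ?_⟩
      · exact (Metric.ball_subset_ball (by dsimp only [ε]; linarith)).trans hrV
      · rw [Metric.mem_ball]
        linarith [hdist n A hA x y' hy' y hyA, hε n]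
    · rintro ⟨n, A, hx, hyA⟩
      obtain ⟨y', hy', hTy⟩ := hTf n A y hyA
      rw [hTy] at hx
      obtain ⟨z, hz, hxz⟩ := mem_iUnion₂.1 hx
      refine mem_shrinking.1 hz ?_
      rw [Metric.mem_ball] at hxz ⊢
      linarith [dist_triangle (f (x, y)) (f (x, y')) z, hdist n A A.2 x y hyA y' hy']
  rw [key]
  exact .countable_iUnion fun n => (hσ n).isBorelAdditive_iUnion hα' continuous_snd
    (fun A => (hT n A).prod (hadd n A A.2)) fun A p hp => hp.2
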